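/- Let $K$ be an infinite field, $n\ge 0$, $P=K[x_1,\dots,x_n]$ and $\overline P=K[x_1,\dots,x_{n+1}]$, and let $\overline P_1$ be the space of linear forms in $\overline P$. Definitions. A monomial ideal $I$ is an ideal with a $K$-basis of power products. It is strongly stable if $x_i t/x_j\in I$ for every power product $t\in I$, every $j$ with $x_j\mid t$ and every $i\le j$. A distraction matrix over $\overline P$ is a family $\mathcal L=(L_{ij})_{1\le i\le n+1,\ j\ge 1}$ of elements of $\overline P_1$ such that $L_{1j_1},\dots,L_{n+1,j_{n+1}}$ span $\overline P_1$ for all $j_1,\dots,j_{n+1}$, and for some $N$ one has $L_{ij}=L_{iN}$ for all $i$ and all $j>N$. The operator $D_{\mathcal L}:\overline P\to\overline P$ is the $K$-linear map with $D_{\mathcal L}(x_1^{\alpha_1}\cdots x_{n+1}^{\alpha_{n+1}})=\prod_{i=1}^{n+1}\prod_{j=1}^{\alpha_i}L_{ij}$. For an ideal $I$ of $P$, $D_{\mathcal L}(I)$ denotes the image $D_{\mathcal L}(I\overline P)$. The matrix $\mathcal L$ is radical for a monomial ideal $I$ if for every irreducible component $(x_{i_1}^{a_1},\dots,x_{i_h}^{a_h})$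 of $I$ (that is, every member of the irredundant decomposition of $I$ as an intersection of ideals generated by powers of variables) the subspaces $\langle L_{i_1s_1},\dots,L_{i_hs_h}\rangle$, $1\le s_r\le a_r$, are pairwise distinct for distinct $(s_1,\dots,s_h)$. For a homogeneous ideal $J$ of $\overline P$, $\mathrm{gin}_{\mathrm{drl}}(J)$ is the common value, for all $g$ in some nonempty Zariski open subset of $GL(n+1,K)$, of the ideal generated by the leading power products, for the term ordering DegRevLex with $x_1>\dots>x_{n+1}$, of the nonzero elements of $g(J)$, where $g(x_j)=\sum_i g_{ij}x_i$. Corollary (Gin and Points). Let $I$ be a strongly stable monomial ideal in $P$ with $\dim(P/I)=0$, and let $\mathcal L$ be a distraction matrix over $\overline P$ which is radical for $I$ (extended to $\overline P$). Then $D_{\mathcal L}(I)$ is the ideal of a finite set $Z$ of $K$-rational points in $\mathbb P^n_K$, that is, $D_{\mathcal L}(I)$ equals the ideal generated by the homogeneous polynomials vanishing on $Z$, and $\mathrm{gin}_{\mathrm{drl}}\big(D_{\mathcal L}(I)\big)=I\overline P$. -/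

import Mathlib

namespace GinPoints

/-! ### The degree reverse lexicographic order -/

/-- A copy of the exponent vectors `Fin m →₀ ℕ`, to be ordered by `DegRevLex`. -/
def DRL (m : ℕ) : Type := Fin m →₀ ℕ

namespace DRL

variable {m : ℕ}

noncomputable instance : AddCommMonoid (DRL m) :=
  inferInstanceAs (AddCommMonoid (Fin m →₀ ℕ))

/-- The identity, as an additive equivalence. -/
noncomputable def of : (Fin m →₀ ℕ) ≃+ DRL m := AddEquiv.refl _

/-- Comparison key: first the total degree, then the exponents read from the last variable to the
first one, in reversed order. -/
noncomputable def key (a : Fin m →₀ ℕ) : Lex (ℕ × Lex (Fin m → ℕᵒᵈ)) :=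
  toLex (a.degree, toLex fun i => OrderDual.toDual (a i.rev))

theorem key_injective : Function.Injective (key (m := m)) := by
  intro a b h
  have h2 : (fun i : Fin m => OrderDual.toDual (a i.rev)) = fun i => OrderDual.toDual (b i.rev) :=
    congrArg (fun x : Lex (ℕ × Lex (Fin m → ℕᵒᵈ)) => ofLex (ofLex x).2) h
  ext i
  have := congrFun h2 i.rev
  simpa using this

noncomputable instance : LinearOrder (DRL m) :=
  LinearOrder.lift' (fun a : DRL m => key (of.symm a)) (key_injective.comp of.symm.injective)

/-- With `x₁ > x₂ > ⋯ > x_m` (here `X 0 > X 1 > ⋯`): `a < b` iff the degree of `a` is smaller, or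
the degrees agree and at the last index where `a` and `b` differ, `a` is larger. -/
theorem of_lt_of_iff {a b : Fin m →₀ ℕ} :
    of a < of b ↔ a.degree < b.degree ∨
      (a.degree = b.degree ∧ ∃ i, b i < a i ∧ ∀ k, i < k → a k = b k) := by
  change key a < key b ↔ _
  unfold key
  rw [Prod.Lex.toLex_lt_toLex]
  refine or_congr Iff.rfl (and_congr Iff.rfl ?_)
  change (∃ i : Fin m, (∀ j, j < i → OrderDual.toDual (a j.rev) = OrderDual.toDual (b j.rev)) ∧
    OrderDual.toDual (a i.rev) < OrderDual.toDual (b i.rev)) ↔ _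
  constructor
  · rintro ⟨i, h1, h2⟩
    refine ⟨i.rev, h2, fun k hk => ?_⟩
    have := h1 k.rev (by rwa [Fin.rev_lt_iff])
    simpa using this
  · rintro ⟨i, h1, h2⟩
    refine ⟨i.rev, fun j hj => ?_, by simpa using h1⟩
    exact congrArg _ (h2 j.rev (by rwa [Fin.lt_rev_iff]))

theorem of_add_lt {a b : Fin m →₀ ℕ} (c : Fin m →₀ ℕ) (h : of a < of b) :
    of (c + a) < of (c + b) := by
  rw [of_lt_of_iff] at h ⊢
  simpa using h

instance : IsOrderedAddMonoid (DRL m) where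
  add_le_add_left a b h c := by
    rcases h.lt_or_eq with h | rfl
    · have := of_add_lt (of.symm c) (a := of.symm a) (b := of.symm b) h
      rw [add_comm a c, add_comm b c]
      exact this.le
    · exact le_rfl

theorem of_monotone : Monotone (of (m := m)) := by
  intro a b h
  obtain ⟨c, rfl⟩ := exists_add_of_le h
  have h0 : (0 : DRL m) ≤ of c := by
    by_contra hc
    have hlt : of c < of (0 : Fin m →₀ ℕ) := not_le.mp hc
    rw [of_lt_of_iff] at hlt
    rcases hlt with hlt | ⟨hd, i, hi, _⟩
    · simp at hlt
    · have : c = 0 := by simpa [Finsupp.degree_eq_zero_iff] using hd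
      simp [this] at hi
  rw [map_add]
  exact le_add_of_nonneg_right h0

instance : WellFoundedLT (DRL m) where
  wf := by
    have : WellQuasiOrderedLE (Fin m →₀ ℕ) := inferInstance
    refine wellFounded_iff_isEmpty_descending_chain.mpr ⟨fun ⟨f, hf⟩ => ?_⟩
    obtain ⟨i, j, hij, hle⟩ := wellQuasiOrdered_le (fun k => of.symm (f k))
    have h1 : f i ≤ f j := of_monotone hle
    have h2 : StrictAnti f := strictAnti_nat_of_succ_lt hf
    exact absurd (h2 hij) (not_lt.mpr h1)

end DRL

/-- `DegRevLex` on the power products in `m` variables, with `X 0 > X 1 > ⋯`. -/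
noncomputable def degRevLex (m : ℕ) : MonomialOrder (Fin m) where
  syn := DRL m
  toSyn := DRL.of
  toSyn_monotone := DRL.of_monotone

theorem degRevLex_lt_iff {m : ℕ} {a b : Fin m →₀ ℕ} :
    (degRevLex m).toSyn a < (degRevLex m).toSyn b ↔ a.degree < b.degree ∨
      (a.degree = b.degree ∧ ∃ i, b i < a i ∧ ∀ k, i < k → a k = b k) :=
  DRL.of_lt_of_iff

open MvPolynomial

/-! ### Initial and generic initial ideals -/

/-- The ideal generated by the leading power products of the nonzero elements of `I`. -/
noncomputable def initialIdeal {σ K : Type*} [Field K] (ord : MonomialOrder σ)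
    (I : Ideal (MvPolynomial σ K)) : Ideal (MvPolynomial σ K) :=
  Ideal.span ((fun f => monomial (ord.degree f) (1 : K)) '' {f | f ∈ I ∧ f ≠ 0})

/-- The linear change of coordinates `x_j ↦ ∑ i, g i j • x_i`. -/
noncomputable def coordChange {m : ℕ} {K : Type*} [Field K] (g : GL (Fin m) K) :
    MvPolynomial (Fin m) K →ₐ[K] MvPolynomial (Fin m) K :=
  aeval fun j => ∑ i, C ((g : Matrix (Fin m) (Fin m) K) i j) * X i

/-- `J` is the generic initial ideal of `I`: the initial ideal of `g(I)` is `J` for all `g` in a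
nonempty Zariski open subset of `GL(m, K)`, which may be taken to be the complement of a
hypersurface `F = 0`, with `F` a nonzero polynomial in the entries of `g` (`K` is infinite). -/
def IsGin {m : ℕ} {K : Type*} [Field K] [Infinite K] (ord : MonomialOrder (Fin m))
    (I J : Ideal (MvPolynomial (Fin m) K)) : Prop :=
  ∃ F : MvPolynomial (Fin m × Fin m) K, F ≠ 0 ∧ ∀ g : GL (Fin m) K,
    eval (fun p => (g : Matrix (Fin m) (Fin m) K) p.1 p.2) F ≠ 0 →
      initialIdeal ord (I.map (coordChange g)) = J

/-- The generic initial ideal is unique. -/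
theorem IsGin.unique {m : ℕ} {K : Type*} [Field K] [Infinite K] {ord : MonomialOrder (Fin m)}
    {I J J' : Ideal (MvPolynomial (Fin m) K)} (h : IsGin ord I J) (h' : IsGin ord I J') :
    J = J' := by
  obtain ⟨F, hF, h⟩ := h
  obtain ⟨F', hF', h'⟩ := h'
  have hd : Matrix.det (Matrix.mvPolynomialX (Fin m) (Fin m) K) ≠ 0 :=
    Matrix.det_mvPolynomialX_ne_zero (Fin m) K
  have hne : F * F' * Matrix.det (Matrix.mvPolynomialX (Fin m) (Fin m) K) ≠ 0 :=
    mul_ne_zero (mul_ne_zero hF hF') hd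
  obtain ⟨x, hx⟩ : ∃ x, eval x (F * F' *
      Matrix.det (Matrix.mvPolynomialX (Fin m) (Fin m) K)) ≠ 0 := by
    by_contra! hc
    exact hne (MvPolynomial.funext fun x => by rw [hc x, map_zero])
  rw [map_mul, map_mul] at hx
  have hdet : Matrix.det (Matrix.of fun i j => x (i, j)) ≠ 0 := by
    have hh := right_ne_zero_of_mul hx
    rw [RingHom.map_det] at hh
    convert hh using 2
    ext i j
    simp
  have hl := left_ne_zero_of_mul hx
  let g : GL (Fin m) K := Matrix.GeneralLinearGroup.mkOfDetNeZero _ hdet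
  rw [← h g (left_ne_zero_of_mul hl), ← h' g (right_ne_zero_of_mul hl)]

/-! ### Monomial ideals -/

/-- `I` has a `K`-basis of power products. -/
def IsMonomialIdeal {σ K : Type*} [Field K] (I : Ideal (MvPolynomial σ K)) : Prop :=
  ∃ T : Set (σ →₀ ℕ), I.restrictScalars K =
    Submodule.span K ((fun t => monomial t (1 : K)) '' T)

/-- `x_i t / x_j ∈ I` for every power product `t ∈ I` with `x_j ∣ t` and every `i ≤ j`. -/
def IsStronglyStable {m : ℕ} {K : Type*} [Field K] (I : Ideal (MvPolynomial (Fin m) K)) : Prop :=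
  ∀ t : Fin m →₀ ℕ, monomial t (1 : K) ∈ I → ∀ i j : Fin m, i ≤ j → t j ≠ 0 →
    monomial (t - Finsupp.single j 1 + Finsupp.single i 1) (1 : K) ∈ I

/-- The ideal generated by the powers `x_i ^ a_i`, for those `i` with `a_i ≠ 0`. -/
noncomputable def irreducibleMonomialIdeal {σ : Type*} (K : Type*) [Field K] (a : σ →₀ ℕ) :
    Ideal (MvPolynomial σ K) :=
  Ideal.span ((fun i => (X i : MvPolynomial σ K) ^ a i) '' (a.support : Set σ))

/-- `I` is the intersection of the irreducible monomial ideals with exponents in `A`, and none of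
these can be omitted. -/
def IsIrreducibleDecomposition {σ K : Type*} [Field K] (I : Ideal (MvPolynomial σ K))
    (A : Finset (σ →₀ ℕ)) : Prop :=
  A.inf (irreducibleMonomialIdeal K) = I ∧ ∀ B ⊂ A, B.inf (irreducibleMonomialIdeal K) ≠ I

/-- The irreducible monomial ideal with exponents `a` is an irreducible component of `I`. -/
def IsIrreducibleComponent {σ K : Type*} [Field K] (I : Ideal (MvPolynomial σ K))
    (a : σ →₀ ℕ) : Prop :=
  ∃ A : Finset (σ →₀ ℕ), IsIrreducibleDecomposition I A ∧ a ∈ A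

/-! ### Distractions -/

/-- Rows are indexed by the variables. Columns are numbered from `0`, so the `j`-th entry
of the `i`-th row is `L i (j - 1)`, for `j ≥ 1`. -/
structure IsDistractionMatrix {σ K : Type*} [Field K] (L : σ → ℕ → MvPolynomial σ K) : Prop where
  linear : ∀ i j, (L i j).IsHomogeneous 1
  span_eq : ∀ j : σ → ℕ,
    Submodule.span K (Set.range fun i => L i (j i)) = homogeneousSubmodule σ K 1
  eventually_const : ∃ N : ℕ, ∀ i, ∀ j, N ≤ j → L i j = L i N

/-- The `K`-linear operator sending a power product `∏ x_i ^ α_i` to the product, over all `i`, of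
the first `α_i` entries of the `i`-th row of `L`. -/
noncomputable def distraction {σ K : Type*} [Fintype σ] [Field K] (L : σ → ℕ → MvPolynomial σ K) :
    MvPolynomial σ K →ₗ[K] MvPolynomial σ K :=
  (basisMonomials σ K).constr K fun α => ∏ i, ∏ j ∈ Finset.range (α i), L i j

theorem distraction_monomial {σ K : Type*} [Fintype σ] [Field K] (L : σ → ℕ → MvPolynomial σ K)
    (α : σ →₀ ℕ) :
    distraction L (monomial α 1) = ∏ i, ∏ j ∈ Finset.range (α i), L i j := by
  have h := (basisMonomials σ K).constr_basis K
    (fun α : σ →₀ ℕ => ∏ i, ∏ j ∈ Finset.range (α i), L i j) α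
  rwa [coe_basisMonomials] at h

/-- `L` is radical for the irreducible monomial ideal with exponents `a`: the vector spaces
spanned by one entry from among the first `a_i` in the `i`-th row, for each `i` with `a_i ≠ 0`,
are pairwise distinct for different choices. -/
def IsRadicalForIrreducible {σ K : Type*} [Field K] (L : σ → ℕ → MvPolynomial σ K)
    (a : σ →₀ ℕ) : Prop :=
  Set.InjOn (fun s : a.support → ℕ => Submodule.span K (Set.range fun i : a.support => L i (s i)))
    {s | ∀ i, s i < a i}

/-- `L` is radical for all the irreducible components of `I`. -/
def IsRadicalFor {σ K : Type*} [Field K] (L : σ → ℕ → MvPolynomial σ K)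
    (I : Ideal (MvPolynomial σ K)) : Prop :=
  ∀ a, IsIrreducibleComponent I a → IsRadicalForIrreducible L a

/-! ### Extension by one variable and points -/

/-- The extension of an ideal of `K[x_1, …, x_n]` to `K[x_1, …, x_{n+1}]`. -/
noncomputable def extendIdeal {n : ℕ} {K : Type*} [Field K] (I : Ideal (MvPolynomial (Fin n) K)) :
    Ideal (MvPolynomial (Fin (n + 1)) K) :=
  I.map (rename (R := K) (Fin.castSucc : Fin n → Fin (n + 1)))

/-- The ideal generated by the homogeneous polynomials that vanish at all points of `Z`. -/
noncomputable def idealOfPoints {n : ℕ} {K : Type*} [Field K]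
    (Z : Set (Projectivization K (Fin (n + 1) → K))) : Ideal (MvPolynomial (Fin (n + 1)) K) :=
  Ideal.span {f | (∃ d, f.IsHomogeneous d) ∧ ∀ p ∈ Z, eval p.rep f = 0}

end GinPoints

open GinPoints

/-! Write `E` for the extension of `I` and `D` for the distraction. Two independent arguments meet
in the final theorem.

Points. For an exponent vector `o` let `v o` be a nonzero common zero of the `n` forms `L i (o i)`,
`i ≠ last`. No entry of the last row vanishes there, since those `n` forms together with any such
entry span all linear forms. Hence `D(t)` vanishes at `v o` as soon as `o i < t i` for some `i ≠
last`. If `o` is standard (no last variable, not in `E`) and `t` agrees with `o` off the last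
variable, then `D(t)` does not vanish at `v o`: this is what radicality provides
(`eval_ne_zero_of_isRadicalForIrreducible`). Evaluation at the points is therefore triangular. Since
`D` is surjective (`distraction_surjective`), this shows that `D(E)` is exactly the ideal of the
finitely many points `v o`, `o` standard (`map_distraction_eq_idealOfPoints`). In particular it is
an ideal.

Gin. For generic `g`, the forms `g (L i (u i))` with `i ≤ s` have a combination equal to `x_s`
modulo the later variables. Strong stability allows `x_s` to be traded for any `x_i` with `i ≤ s`,
so every `t ∈ E` can be built, variable by variable, into a combination of distractions of elements
of `E` of degree `t.degree` whose DegRevLex leading power product is `t`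
(`exists_mem_distractionSpan_leadingTerm`). A dimension count in each degree then excludes all other
leading power products (`initialIdeal_eq_of_leadingTerms`). -/

namespace GinPoints

open MvPolynomial

/-! ### Distractions of power products -/

section Distraction

variable {σ K : Type*} [Fintype σ] [Field K]

theorem distraction_monomial_add_single (L : σ → ℕ → MvPolynomial σ K) (u : σ →₀ ℕ) (i : σ) :
    distraction L (monomial (u + Finsupp.single i 1) 1) =
      L i (u i) * distraction L (monomial u 1) := by
  classical
  rw [distraction_monomial, distraction_monomial, ← Finset.mul_prod_erase _ _ (Finset.mem_univ i),
    ← Finset.mul_prod_erase Finset.univ (fun i => ∏ j ∈ Finset.range (u i), L i j)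
      (Finset.mem_univ i), ← mul_assoc]
  congr 1
  · rw [Finsupp.add_apply, Finsupp.single_eq_same, Finset.prod_range_succ, mul_comm]
  · refine Finset.prod_congr rfl fun k hk => ?_
    rw [Finsupp.add_apply, Finsupp.single_eq_of_ne (Finset.ne_of_mem_erase hk), add_zero]

theorem distraction_monomial_zero (L : σ → ℕ → MvPolynomial σ K) :
    distraction L (monomial 0 1) = 1 := by
  rw [distraction_monomial]; simp

theorem isHomogeneous_distraction_monomial {L : σ → ℕ → MvPolynomial σ K}
    (hL : ∀ i j, (L i j).IsHomogeneous 1) (u : σ →₀ ℕ) :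
    (distraction L (monomial u 1)).IsHomogeneous u.degree := by
  rw [distraction_monomial, Finsupp.degree_eq_sum]
  refine IsHomogeneous.prod _ _ _ fun i _ => ?_
  simpa using IsHomogeneous.prod (Finset.range (u i)) (L i) (fun _ => 1) fun j _ => hL i j

theorem homogeneousComponent_distraction {L : σ → ℕ → MvPolynomial σ K}
    (hL : ∀ i j, (L i j).IsHomogeneous 1) (d : ℕ) (f : MvPolynomial σ K) :
    homogeneousComponent d (distraction L f) = distraction L (homogeneousComponent d f) := by
  suffices h : homogeneousComponent d ∘ₗ distraction L = distraction L ∘ₗ homogeneousComponent d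
    from LinearMap.congr_fun h f
  refine (basisMonomials σ K).ext fun u => ?_
  simp only [coe_basisMonomials, LinearMap.comp_apply]
  by_cases h : u.degree = d
  · rw [homogeneousComponent_of_mem (isHomogeneous_distraction_monomial hL u),
      homogeneousComponent_of_mem (isHomogeneous_monomial (1 : K) h), if_pos h.symm, if_pos rfl]
  · rw [homogeneousComponent_of_mem (isHomogeneous_distraction_monomial hL u),
      homogeneousComponent_of_mem (isHomogeneous_monomial (1 : K) rfl), if_neg (Ne.symm h),
      if_neg (Ne.symm h), map_zero]

theorem algHom_distraction (φ : MvPolynomial σ K →ₐ[K] MvPolynomial σ K)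
    (L : σ → ℕ → MvPolynomial σ K) (f : MvPolynomial σ K) :
    φ (distraction L f) = distraction (fun i j => φ (L i j)) f := by
  suffices h : φ.toLinearMap ∘ₗ distraction L = distraction fun i j => φ (L i j)
    from LinearMap.congr_fun h f
  refine (basisMonomials σ K).ext fun u => ?_
  simp [distraction_monomial]

theorem distraction_eq_sum (L : σ → ℕ → MvPolynomial σ K) (f : MvPolynomial σ K) :
    distraction L f = ∑ t ∈ f.support, coeff t f • distraction L (monomial t 1) := by
  conv_lhs => rw [f.as_sum]
  rw [map_sum]
  refine Finset.sum_congr rfl fun t _ => ?_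
  rw [← map_smul, smul_monomial, smul_eq_mul, mul_one]

theorem distraction_monomial_single_add [DecidableEq σ] (L : σ → ℕ → MvPolynomial σ K) (i : σ)
    (f : MvPolynomial σ K) :
    L i 0 * distraction (Function.update L i fun j => L i (j + 1)) f = distraction L (X i * f) := by
  suffices h : LinearMap.mulLeft K (L i 0) ∘ₗ distraction (Function.update L i fun j => L i (j + 1))
      = distraction L ∘ₗ LinearMap.mulLeft K (X i) from LinearMap.congr_fun h f
  refine (basisMonomials σ K).ext fun u => ?_
  simp only [coe_basisMonomials, LinearMap.comp_apply, LinearMap.mulLeft_apply]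
  rw [X, monomial_mul, one_mul, distraction_monomial, distraction_monomial,
    ← Finset.mul_prod_erase _ _ (Finset.mem_univ i),
    ← Finset.mul_prod_erase Finset.univ _ (Finset.mem_univ i), ← mul_assoc]
  congr 1
  · rw [Finsupp.add_apply, Finsupp.single_eq_same, add_comm 1, Finset.prod_range_succ', mul_comm,
      Function.update_self]
  · refine Finset.prod_congr rfl fun k hk => ?_
    rw [Finsupp.add_apply, Finsupp.single_eq_of_ne (Finset.ne_of_mem_erase hk), zero_add,
      Function.update_of_ne (Finset.ne_of_mem_erase hk)]

/-- Induction on the degree: a variable dividing `t` is a combination of the first column, and `L i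
0` times a distraction for the matrix with row `i` shifted by one is again a distraction for `L`. -/
theorem distraction_surjective {L : σ → ℕ → MvPolynomial σ K}
    (hL : ∀ (j : σ → ℕ) (k : σ), X k ∈ Submodule.span K (Set.range fun i => L i (j i))) :
    Function.Surjective (distraction L) := by
  classical
  rw [← LinearMap.range_eq_top, eq_top_iff, ← (basisMonomials σ K).span_eq, Submodule.span_le]
  rintro _ ⟨t, rfl⟩
  rw [coe_basisMonomials]
  change monomial t (1 : K) ∈ LinearMap.range (distraction L)
  induction hd : t.degree generalizing t L with
  | zero =>
    rw [Finsupp.degree_eq_zero_iff] at hd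
    exact ⟨monomial 0 1, by rw [hd, distraction_monomial_zero]; rfl⟩
  | succ d ih =>
    obtain ⟨k, hk⟩ : ∃ k, t k ≠ 0 := by
      by_contra! h
      rw [show t = 0 from Finsupp.ext h] at hd
      simp at hd
    have ht : Finsupp.single k 1 + (t - Finsupp.single k 1) = t :=
      add_tsub_cancel_of_le (by simpa using Nat.one_le_iff_ne_zero.mpr hk)
    have hdeg : (t - Finsupp.single k 1).degree = d := by
      have := congrArg Finsupp.degree ht
      rw [map_add, Finsupp.degree_single, hd] at this
      omega
    obtain ⟨c, hc⟩ := (Submodule.mem_span_range_iff_exists_fun K).mp (hL 0 k)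
    have hX : monomial t (1 : K) = ∑ i, c i • (L i 0 * monomial (t - Finsupp.single k 1) 1) := by
      simp_rw [← smul_mul_assoc]
      rw [← Finset.sum_mul]
      have : ∑ i, c i • L i 0 = X k := hc
      rw [this, X, monomial_mul, one_mul, ht]
    rw [hX]
    refine Submodule.sum_mem _ fun i _ => Submodule.smul_mem _ _ ?_
    -- The shifted matrix keeps the spanning property: a choice `j` of columns in it is the choice
    -- `j` in `L` with the entry at `i` raised by one.
    obtain ⟨g, hg⟩ := @ih (Function.update L i fun j => L i (j + 1)) (fun j k => by
      have := hL (Function.update j i (j i + 1)) k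
      convert this using 4 with x
      by_cases hx : x = i
      · subst hx; simp
      · simp [hx]) _ hdeg
    exact ⟨X i * g, by rw [← distraction_monomial_single_add, hg]⟩

end Distraction

/-! ### Leading terms for the degree reverse lexicographic order -/

section LeadingTerm

variable {m : ℕ} {K : Type*} [Field K]

theorem degree_eq_of_forall_le {σ : Type*} {ord : MonomialOrder σ} {f : MvPolynomial σ K}
    {t : σ →₀ ℕ} (ht : coeff t f ≠ 0) (h : ∀ v ∈ f.support, ord.toSyn v ≤ ord.toSyn t) :
    ord.degree f = t := by
  apply ord.toSyn.injective
  exact le_antisymm (ord.degree_le_iff.mpr h) (ord.le_degree (mem_support_iff.mpr ht))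

/-- This is where the order being DegRevLex matters: in a fixed degree, terms in the ideal of the
variables after `s` never beat a term free of them. -/
theorem degRevLex_lt_of_gt_support {v t : Fin m →₀ ℕ} (hd : v.degree = t.degree) {s : Fin m}
    (ht : ∀ k, s < k → t k = 0) (hv : ∃ k, s < k ∧ v k ≠ 0) :
    (degRevLex m).toSyn v < (degRevLex m).toSyn t := by
  rw [degRevLex_lt_iff]
  refine Or.inr ⟨hd, ?_⟩
  obtain ⟨k, hk, hvk⟩ := hv
  have hne : v.support.Nonempty := ⟨k, by simpa using hvk⟩
  have hmax := v.support.max'_mem hne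
  have hk' : k ≤ v.support.max' hne := Finset.le_max' _ _ (by simpa using hvk)
  refine ⟨v.support.max' hne, ?_, fun l hl => ?_⟩
  · rw [ht _ (hk.trans_le hk')]
    exact Nat.pos_of_ne_zero (by simpa using hmax)
  · rw [ht l ((hk.trans_le hk').trans hl)]
    by_contra h
    exact absurd (Finset.le_max' v.support l (by simpa using h)) (not_le.mpr hl)

/-- The distractions of the power products which lie in `S`, up to a common factor, as soon as
`t` does. -/
noncomputable def distractionSpan (L : Fin m → ℕ → MvPolynomial (Fin m) K) (S : Set (Fin m →₀ ℕ))
    (t : Fin m →₀ ℕ) : Submodule K (MvPolynomial (Fin m) K) :=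
  Submodule.span K ((fun u => distraction L (monomial u 1)) ''
    {u | u.degree = t.degree ∧ ∀ w, t + w ∈ S → u + w ∈ S})

theorem distractionSpan_le_homogeneousSubmodule {L : Fin m → ℕ → MvPolynomial (Fin m) K}
    (hlin : ∀ i j, (L i j).IsHomogeneous 1) (S : Set (Fin m →₀ ℕ)) (t : Fin m →₀ ℕ) :
    distractionSpan L S t ≤ homogeneousSubmodule (Fin m) K t.degree := by
  refine Submodule.span_le.mpr ?_
  rintro _ ⟨u, ⟨hu, -⟩, rfl⟩
  rw [SetLike.mem_coe, mem_homogeneousSubmodule, ← hu]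
  exact isHomogeneous_distraction_monomial hlin u

/-- Multiplying `D(u)` by `L i (u i)` gives `D(x_i u)`, so the combination from `hgen` imitates
multiplication by `x_s` inside distractions. Its coefficients depend on `u`, so the replacement is
made generator by generator. -/
theorem exists_mem_distractionSpan_sub_X_mul_mem {L : Fin m → ℕ → MvPolynomial (Fin m) K}
    {S : Set (Fin m →₀ ℕ)}
    (hS : ∀ t ∈ S, ∀ i j : Fin m, i ≤ j → t j ≠ 0 →
      t - Finsupp.single j 1 + Finsupp.single i 1 ∈ S) {s : Fin m}
    (hgen : ∀ u : Fin m → ℕ, ∃ c : Fin m → K, (∀ i, s < i → c i = 0) ∧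
      (∑ i, c i • L i (u i)) - X s ∈ Ideal.span ((X : Fin m → MvPolynomial (Fin m) K) '' Set.Ioi s))
    {t : Fin m →₀ ℕ} {f : MvPolynomial (Fin m) K} (hf : f ∈ distractionSpan L S t) :
    ∃ f' ∈ distractionSpan L S (t + Finsupp.single s 1),
      f' - X s * f ∈ Ideal.span ((X : Fin m → MvPolynomial (Fin m) K) '' Set.Ioi s) := by
  induction hf using Submodule.span_induction with
  | mem x hx =>
    obtain ⟨u, ⟨hu, hu'⟩, rfl⟩ := hx
    obtain ⟨c, hc, hc'⟩ := hgen u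
    refine ⟨(∑ i, c i • L i (u i)) * distraction L (monomial u 1), ?_, ?_⟩
    · rw [Finset.sum_mul]
      refine Submodule.sum_mem _ fun i _ => ?_
      rw [smul_mul_assoc, ← distraction_monomial_add_single]
      by_cases hi : s < i
      · rw [hc i hi, zero_smul]
        exact Submodule.zero_mem _
      · refine Submodule.smul_mem _ _ (Submodule.subset_span
          ⟨_, ⟨by simp [hu], fun w hw => ?_⟩, rfl⟩)
        -- The arbitrary cofactor `w` in `distractionSpan` absorbs `x_s`; strong stability then
        -- exchanges this `x_s` for `x_i`, which needs `i ≤ s`.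
        have h1 := hu' (Finsupp.single s 1 + w) (by rwa [← add_assoc])
        have h2 := hS _ h1 i s (not_lt.mp hi) (by simp)
        convert h2 using 1
        ext k
        simp only [Finsupp.add_apply, Finsupp.tsub_apply]
        omega
    · rw [← sub_mul]
      exact Ideal.mul_mem_right _ _ hc'
  | zero => exact ⟨0, Submodule.zero_mem _, by simp⟩
  | add x y _ _ hx hy =>
    obtain ⟨x', hx', hx⟩ := hx
    obtain ⟨y', hy', hy⟩ := hy
    refine ⟨x' + y', Submodule.add_mem _ hx' hy', ?_⟩
    convert Ideal.add_mem _ hx hy using 1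
    ring
  | smul a x _ hx =>
    obtain ⟨x', hx', hx⟩ := hx
    refine ⟨a • x', Submodule.smul_mem _ _ hx', ?_⟩
    rw [mul_smul_comm, ← smul_sub]
    exact Submodule.smul_of_tower_mem _ a hx

/-- Induction on the degree, removing the last variable `x_s` of `t`. The new element is `x_s f` up
to terms involving later variables, which are smaller than `t`. The induction passes through
divisors of `t` outside `S`, hence no assumption `t ∈ S`. -/
theorem exists_mem_distractionSpan_leadingTerm {L : Fin m → ℕ → MvPolynomial (Fin m) K}
    (hlin : ∀ i j, (L i j).IsHomogeneous 1) {S : Set (Fin m →₀ ℕ)}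
    (hS : ∀ t ∈ S, ∀ i j : Fin m, i ≤ j → t j ≠ 0 →
      t - Finsupp.single j 1 + Finsupp.single i 1 ∈ S)
    (hgen : ∀ (s : Fin m) (u : Fin m → ℕ), ∃ c : Fin m → K, (∀ i, s < i → c i = 0) ∧
      (∑ i, c i • L i (u i)) - X s ∈ Ideal.span ((X : Fin m → MvPolynomial (Fin m) K) '' Set.Ioi s))
    (t : Fin m →₀ ℕ) :
    ∃ f ∈ distractionSpan L S t, coeff t f ≠ 0 ∧
      ∀ v ∈ f.support, (degRevLex m).toSyn v ≤ (degRevLex m).toSyn t := by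
  induction hd : t.degree generalizing t with
  | zero =>
    rw [Finsupp.degree_eq_zero_iff] at hd
    subst hd
    refine ⟨1, Submodule.subset_span ⟨0, ⟨rfl, fun w h => h⟩, distraction_monomial_zero L⟩,
      by simp, fun v hv => ?_⟩
    rw [show v = 0 by simpa [eq_comm, coeff_one] using hv]
  | succ d ih =>
    have hne : t.support.Nonempty := by
      rw [Finsupp.support_nonempty_iff]
      rintro rfl
      simp at hd
    obtain ⟨s, hts, hgt⟩ : ∃ s, t s ≠ 0 ∧ ∀ k, s < k → t k = 0 := by
      refine ⟨t.support.max' hne, by simpa using t.support.max'_mem hne, fun k hk => ?_⟩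
      by_contra h
      exact absurd (Finset.le_max' t.support k (by simpa using h)) (not_le.mpr hk)
    obtain ⟨t', rfl⟩ : ∃ t', t = t' + Finsupp.single s 1 :=
      ⟨t - Finsupp.single s 1,
        (tsub_add_cancel_of_le (by simpa using Nat.one_le_iff_ne_zero.mpr hts)).symm⟩
    obtain ⟨f, hf, hft, hfle⟩ := ih t' (by simpa using hd)
    obtain ⟨f', hf', hsub⟩ := exists_mem_distractionSpan_sub_X_mul_mem hS (hgen s) hf
    rw [mem_ideal_span_X_image] at hsub
    have hdec : f' = X s * f + (f' - X s * f) := by ring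
    refine ⟨f', hf', ?_, fun v hv => ?_⟩
    · rw [hdec, coeff_add, add_comm t', coeff_X_mul]
      convert hft using 1
      rw [add_eq_left]
      by_contra h
      obtain ⟨k, hk, hk'⟩ := hsub _ (mem_support_iff.mpr h)
      rw [add_comm] at hk'
      exact hk' (hgt k hk)
    · have hvd : v.degree = (t' + Finsupp.single s 1).degree := by
        by_contra h
        exact mem_support_iff.mp hv
          (IsHomogeneous.coeff_eq_zero
            (distractionSpan_le_homogeneousSubmodule hlin S _ hf') h)
      by_cases h : v ∈ (f' - X s * f).support
      · exact (degRevLex_lt_of_gt_support hvd hgt (hsub v h)).le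
      · have : v ∈ (X s * f).support := by
          rw [notMem_support_iff] at h
          rw [mem_support_iff] at hv ⊢
          rwa [hdec, coeff_add, h, add_zero] at hv
        rw [support_X_mul, Finset.mem_map] at this
        obtain ⟨v', hv', rfl⟩ := this
        rw [addLeftEmbedding_apply, add_comm, map_add, map_add]
        exact add_le_add_left (hfle v' hv') _

/-- Distinct leading terms cannot cancel: the largest `e i` with `c i ≠ 0` survives. -/
theorem toSyn_degree_sum_mem {σ ι : Type*} {ord : MonomialOrder σ} (s : Finset ι)
    {f : ι → MvPolynomial σ K} {e : ι → σ →₀ ℕ} (he : Function.Injective e)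
    (hf : ∀ i, coeff (e i) (f i) ≠ 0)
    (hle : ∀ i, ∀ v ∈ (f i).support, ord.toSyn v ≤ ord.toSyn (e i)) {c : ι → K}
    (hc : ∃ i ∈ s, c i ≠ 0) :
    ∃ i, ∑ i ∈ s, c i • f i ≠ 0 ∧ ord.degree (∑ i ∈ s, c i • f i) = e i := by
  classical
  obtain ⟨i₀, hi₀, hci₀⟩ := hc
  obtain ⟨i, hi, hmax⟩ := (s.filter fun i => c i ≠ 0).exists_max_image (fun i => ord.toSyn (e i))
    ⟨i₀, by simp [hi₀, hci₀]⟩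
  rw [Finset.mem_filter] at hi
  have hcoef : coeff (e i) (∑ i ∈ s, c i • f i) ≠ 0 := by
    rw [coeff_sum, Finset.sum_eq_single i]
    · rw [coeff_smul, smul_eq_mul]
      exact mul_ne_zero hi.2 (hf i)
    · intro k hk hki
      rw [coeff_smul, smul_eq_mul]
      by_cases hck : c k = 0
      · rw [hck, zero_mul]
      · have h1 := hmax k (by simp [hk, hck])
        rw [mul_eq_zero]
        right
        by_contra h
        have h2 := hle k _ (mem_support_iff.mpr h)
        exact hki (he (ord.toSyn.injective (le_antisymm h1 h2)))
    · exact fun h => absurd hi.1 h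
  refine ⟨i, fun h => hcoef (by rw [h, coeff_zero]), degree_eq_of_forall_le hcoef fun v hv => ?_⟩
  obtain ⟨k, hk, hkv⟩ : ∃ k ∈ s, coeff v (c k • f k) ≠ 0 := by
    by_contra! h
    rw [mem_support_iff, coeff_sum] at hv
    exact hv (Finset.sum_eq_zero h)
  rw [coeff_smul, smul_eq_mul] at hkv
  exact (hle k v (mem_support_iff.mpr (right_ne_zero_of_mul hkv))).trans
    (hmax k (by simp [hk, left_ne_zero_of_mul hkv]))

end LeadingTerm

/-! ### Linear forms -/

section LinearForm

variable {σ K : Type*} [Field K]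

theorem exists_eq_single_of_degree_eq_one {v : σ →₀ ℕ} (hv : v.degree = 1) :
    ∃ k, v = Finsupp.single k 1 := by
  obtain ⟨k, hk⟩ : ∃ k, v k ≠ 0 := by
    by_contra! h
    rw [show v = 0 from Finsupp.ext h] at hv
    simp at hv
  have h := tsub_add_cancel_of_le
    (show Finsupp.single k 1 ≤ v by simpa using Nat.one_le_iff_ne_zero.mpr hk)
  have h' := congrArg Finsupp.degree h
  rw [map_add, Finsupp.degree_single, hv, add_eq_right, Finsupp.degree_eq_zero_iff] at h'
  exact ⟨k, by rw [← h, h', zero_add]⟩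

theorem coeff_single_one_X [DecidableEq σ] (i k : σ) :
    coeff (Finsupp.single k 1) (X i : MvPolynomial σ K) = if i = k then 1 else 0 := by
  classical
  rw [coeff_X]
  exact if_congr (Finsupp.single_left_inj one_ne_zero) rfl rfl

theorem IsHomogeneous.eq_sum_coeff_smul_X [Fintype σ] {f : MvPolynomial σ K}
    (hf : f.IsHomogeneous 1) : f = ∑ k, coeff (Finsupp.single k 1) f • X k := by
  classical
  have key : ∀ k, coeff (Finsupp.single k 1) (∑ k, coeff (Finsupp.single k 1) f • (X k :
      MvPolynomial σ K)) = coeff (Finsupp.single k 1) f := fun k => by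
    rw [coeff_sum, Finset.sum_eq_single k]
    · simp
    · intro l _ hl
      rw [coeff_smul, coeff_single_one_X, if_neg hl, smul_zero]
    · simp
  ext v
  by_cases hv : v.degree = 1
  · obtain ⟨k, rfl⟩ := exists_eq_single_of_degree_eq_one hv
    exact (key k).symm
  · rw [hf.coeff_eq_zero hv, IsHomogeneous.coeff_eq_zero _ hv]
    exact (homogeneousSubmodule σ K 1).sum_mem fun k _ =>
      Submodule.smul_mem _ _ (isHomogeneous_X K k)

theorem IsDistractionMatrix.X_mem {L : σ → ℕ → MvPolynomial σ K} (hL : IsDistractionMatrix L)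
    (j : σ → ℕ) (k : σ) : X k ∈ Submodule.span K (Set.range fun i => L i (j i)) := by
  rw [hL.span_eq]
  exact isHomogeneous_X K k

end LinearForm

/-! ### Changes of coordinates -/

section CoordChange

variable {m : ℕ} {K : Type*} [Field K]

theorem coordChange_X (g : GL (Fin m) K) (k : Fin m) :
    coordChange g (X k) = ∑ i, (g : Matrix (Fin m) (Fin m) K) i k • X i := by
  simp [coordChange, smul_eq_C_mul]

theorem coordChange_comp_inv (g : GL (Fin m) K) (f : MvPolynomial (Fin m) K) :
    coordChange g (coordChange g⁻¹ f) = f := by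
  suffices h : (coordChange g).comp (coordChange g⁻¹) = AlgHom.id K _ from
    AlgHom.congr_fun h f
  refine MvPolynomial.algHom_ext fun k => ?_
  rw [AlgHom.comp_apply, coordChange_X, map_sum, AlgHom.id_apply]
  simp_rw [map_smul, coordChange_X, Finset.smul_sum, smul_smul]
  rw [Finset.sum_comm]
  simp_rw [← Finset.sum_smul]
  have : ∀ i, ∑ l, ((g⁻¹ : GL (Fin m) K) : Matrix (Fin m) (Fin m) K) l k *
      (g : Matrix (Fin m) (Fin m) K) i l = (1 : Matrix (Fin m) (Fin m) K) i k := fun i => by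
    rw [← Units.mul_inv g, Matrix.mul_apply]
    exact Finset.sum_congr rfl fun l _ => mul_comm _ _
  simp_rw [this, Matrix.one_apply]
  simp

theorem coordChange_surjective (g : GL (Fin m) K) : Function.Surjective (coordChange g) :=
  fun f => ⟨_, coordChange_comp_inv g f⟩

theorem isHomogeneous_coordChange (g : GL (Fin m) K) {f : MvPolynomial (Fin m) K}
    (hf : f.IsHomogeneous 1) : (coordChange g f).IsHomogeneous 1 := by
  rw [IsHomogeneous.eq_sum_coeff_smul_X hf, map_sum]
  refine (homogeneousSubmodule (Fin m) K 1).sum_mem fun k _ => ?_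
  rw [map_smul, coordChange_X]
  exact Submodule.smul_mem _ _ (Submodule.sum_mem _ fun i _ =>
    Submodule.smul_mem _ _ (isHomogeneous_X K i))

theorem coeff_coordChange (g : GL (Fin m) K) {f : MvPolynomial (Fin m) K}
    (hf : f.IsHomogeneous 1) (i : Fin m) :
    coeff (Finsupp.single i 1) (coordChange g f) =
      ∑ k, (g : Matrix (Fin m) (Fin m) K) i k * coeff (Finsupp.single k 1) f := by
  classical
  conv_lhs => rw [IsHomogeneous.eq_sum_coeff_smul_X hf]
  rw [map_sum, coeff_sum]
  refine Finset.sum_congr rfl fun k _ => ?_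
  rw [map_smul, coordChange_X, coeff_smul, coeff_sum, Finset.sum_eq_single i]
  · simp [mul_comm]
  · intro l _ hl
    rw [coeff_smul, coeff_single_one_X, if_neg hl, smul_zero]
  · simp

/-- The leading minor of size `s + 1` of the coefficient matrix of `g (ℓ 0), …, g (ℓ (m - 1))`,
as a polynomial in the entries of `g`. -/
noncomputable def leadingMinor (ℓ : Fin m → MvPolynomial (Fin m) K) (s : Fin m) :
    MvPolynomial (Fin m × Fin m) K :=
  Matrix.det (Matrix.of fun r i : {i : Fin m // i ≤ s} =>
    ∑ k, X ((i : Fin m), k) * C (coeff (Finsupp.single k 1) (ℓ r)))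

theorem eval_leadingMinor (ℓ : Fin m → MvPolynomial (Fin m) K) (s : Fin m)
    (x : Fin m × Fin m → K) :
    eval x (leadingMinor ℓ s) = Matrix.det (Matrix.of fun r i : {i : Fin m // i ≤ s} =>
      ∑ k, x ((i : Fin m), k) * coeff (Finsupp.single k 1) (ℓ r)) := by
  rw [leadingMinor, RingHom.map_det]
  congr 1
  ext r i
  simp

theorem leadingMinor_ne_zero {ℓ : Fin m → MvPolynomial (Fin m) K}
    (hX : ∀ k, X k ∈ Submodule.span K (Set.range ℓ)) (s : Fin m) : leadingMinor ℓ s ≠ 0 := by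
  choose B hB using fun k => (Submodule.mem_span_range_iff_exists_fun K).mp (hX k)
  have h1 : Matrix.of B * Matrix.of (fun r k => coeff (Finsupp.single k 1) (ℓ r)) = 1 := by
    ext i k
    rw [Matrix.mul_apply]
    have := congrArg (coeff (Finsupp.single k 1)) (hB i)
    rw [coeff_sum, coeff_single_one_X] at this
    simpa [Matrix.one_apply] using this
  have h2 := mul_eq_one_comm.mp h1
  intro h
  -- This matrix, the transpose of `B`, sends each `ℓ r` to `x_r`, so all its leading minors are
  -- `1`.
  have h3 := eval_leadingMinor ℓ s fun p => B p.2 p.1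
  rw [h, map_zero] at h3
  have h4 : (Matrix.of fun r i : {i : Fin m // i ≤ s} =>
      ∑ k, B k (i : Fin m) * coeff (Finsupp.single k 1) (ℓ r)) = 1 := by
    ext r i
    have := congrFun (congrFun h2 r) i
    rw [Matrix.mul_apply] at this
    simp only [Matrix.of_apply, mul_comm (B _ _)] at this ⊢
    rw [this, Matrix.one_apply, Matrix.one_apply]
    simp [Subtype.ext_iff]
  rw [h4, Matrix.det_one] at h3
  exact zero_ne_one h3

theorem exists_sum_smul_sub_X_mem {g : GL (Fin m) K} {ℓ : Fin m → MvPolynomial (Fin m) K}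
    (hℓ : ∀ r, (ℓ r).IsHomogeneous 1) {s : Fin m}
    (hg : eval (fun p => (g : Matrix (Fin m) (Fin m) K) p.1 p.2) (leadingMinor ℓ s) ≠ 0) :
    ∃ c : Fin m → K, (∀ i, s < i → c i = 0) ∧ (∑ i, c i • coordChange g (ℓ i)) - X s ∈
      Ideal.span ((X : Fin m → MvPolynomial (Fin m) K) '' Set.Ioi s) := by
  classical
  rw [eval_leadingMinor] at hg
  simp_rw [← coeff_coordChange g (hℓ _)] at hg
  set A := Matrix.of fun r i : {i : Fin m // i ≤ s} =>
    coeff (Finsupp.single (i : Fin m) 1) (coordChange g (ℓ r))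
  let e : {i : Fin m // i ≤ s} → K := Pi.single ⟨s, le_rfl⟩ 1
  -- Coefficients making the part in the variables up to `s` equal to `x_s`; the variables after `s`
  -- are left uncontrolled.
  have hsol : Matrix.vecMul (Matrix.vecMul e A⁻¹) A = e := by
    rw [Matrix.vecMul_vecMul, Matrix.nonsing_inv_mul _ (isUnit_iff_ne_zero.mpr hg),
      Matrix.vecMul_one]
  set b := Matrix.vecMul e A⁻¹
  refine ⟨fun i => if h : i ≤ s then b ⟨i, h⟩ else 0, fun i hi => dif_neg (not_le.mpr hi), ?_⟩
  rw [mem_ideal_span_X_image]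
  intro v hv
  have hhom : ((∑ i, (if h : i ≤ s then b ⟨i, h⟩ else 0) • coordChange g (ℓ i)) -
      X s).IsHomogeneous 1 :=
    (homogeneousSubmodule (Fin m) K 1).sub_mem
      (Submodule.sum_mem _ fun i _ => Submodule.smul_mem _ _ (isHomogeneous_coordChange g (hℓ i)))
      (isHomogeneous_X K s)
  obtain ⟨k, rfl⟩ := exists_eq_single_of_degree_eq_one (v := v) (by
    by_contra h
    exact mem_support_iff.mp hv (hhom.coeff_eq_zero h))
  refine ⟨k, ?_, by simp⟩
  by_contra hk
  have hk : k ≤ s := not_lt.mp hk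
  refine mem_support_iff.mp hv ?_
  have h1 := congrFun hsol ⟨k, hk⟩
  rw [Matrix.vecMul, dotProduct] at h1
  rw [coeff_sub, coeff_sum, sub_eq_zero, coeff_single_one_X]
  have h2 : e ⟨k, hk⟩ = if s = k then 1 else 0 := by
    simp only [e, Pi.single_apply, Subtype.ext_iff, eq_comm]
  rw [← h2, ← h1]
  rw [← Finset.sum_subset (Finset.subset_univ (Finset.univ.filter fun i => i ≤ s))]
  · rw [Finset.sum_subtype (p := fun i => i ≤ s) _ (by simp)]
    refine Finset.sum_congr rfl fun i _ => ?_
    dsimp only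
    rw [dif_pos i.2, coeff_smul, smul_eq_mul]
    rfl
  · intro i _ hi
    dsimp only
    rw [dif_neg (by simpa using hi), zero_smul, coeff_zero]

end CoordChange

/-! ### The generic initial ideal of a distraction -/

section Gin

variable {m : ℕ} {K : Type*} [Field K]

theorem finite_setOf_degree_eq (S : Set (Fin m →₀ ℕ)) (d : ℕ) :
    {u | u ∈ S ∧ u.degree = d}.Finite := by
  refine Set.Finite.subset (Set.finite_Iic (Finsupp.equivFunOnFinite.symm fun _ => d)) ?_
  rintro u ⟨-, hu⟩ i
  rw [← hu]
  exact Finsupp.le_degree i u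

/-- In degree `d`, the `F t` with `t ∈ E` are independent, having distinct leading terms, and lie in
the span of equally many distractions. So they span it, and every leading power product there is one
of theirs. Injectivity of the distraction is not required. -/
theorem initialIdeal_eq_of_leadingTerms {L : Fin m → ℕ → MvPolynomial (Fin m) K}
    (hlin : ∀ i j, (L i j).IsHomogeneous 1) {E J : Ideal (MvPolynomial (Fin m) K)}
    (hE : ∀ f, f ∈ E ↔ ∀ t ∈ f.support, monomial t (1 : K) ∈ E)
    (hJ : ∀ f, f ∈ J ↔ ∃ h ∈ E, distraction L h = f)
    (hlead : ∀ t, ∃ f ∈ distractionSpan L {t | monomial t (1 : K) ∈ E} t, coeff t f ≠ 0 ∧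
      ∀ v ∈ f.support, (degRevLex m).toSyn v ≤ (degRevLex m).toSyn t) :
    initialIdeal (degRevLex m) J = E := by
  choose F hF hF0 hFle using hlead
  have hFJ : ∀ t, monomial t (1 : K) ∈ E → F t ∈ Submodule.span K
      ((fun u => distraction L (monomial u 1)) '' {u | monomial u (1 : K) ∈ E ∧
        u.degree = t.degree}) := fun t ht => by
    refine Submodule.span_mono (Set.image_mono ?_) (hF t)
    rintro u ⟨hu, hu'⟩
    refine ⟨?_, hu⟩
    have := hu' 0
    simp only [add_zero] at this
    exact this ht
  apply le_antisymm
  · refine Ideal.span_le.mpr ?_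
    rintro _ ⟨f, ⟨hf, hf0⟩, rfl⟩
    obtain ⟨h, hh, rfl⟩ := (hJ f).mp hf
    set t₀ := (degRevLex m).degree (distraction L h) with ht₀
    set d := t₀.degree
    have hco : coeff t₀ (distraction L h) ≠ 0 :=
      ((degRevLex m).coeff_degree_ne_zero_iff).mpr hf0
    -- the component of degree `d` has the same leading power product
    have hcompl : (degRevLex m).degree (homogeneousComponent d (distraction L h)) = t₀ := by
      refine degree_eq_of_forall_le ?_ fun v hv => ?_
      · rwa [coeff_homogeneousComponent, if_pos rfl]
      · rw [mem_support_iff, coeff_homogeneousComponent] at hv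
        exact (degRevLex m).le_degree (mem_support_iff.mpr (ite_ne_right_iff.mp hv).2)
    have hcomp0 : homogeneousComponent d (distraction L h) ≠ 0 := by
      intro h0
      have := congrArg (coeff t₀) h0
      rw [coeff_homogeneousComponent, if_pos rfl, coeff_zero] at this
      exact hco this
    let T : Set (Fin m →₀ ℕ) := {u | monomial u (1 : K) ∈ E ∧ u.degree = d}
    have : Fintype T := (finite_setOf_degree_eq {u | monomial u (1 : K) ∈ E} d).fintype
    let w : T → MvPolynomial (Fin m) K := fun u => distraction L (monomial u 1)
    let f : T → MvPolynomial (Fin m) K := fun u => F u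
    have hfw : ∀ u : T, f u ∈ Submodule.span K (Set.range w) := fun u => by
      have := hFJ u u.2.1
      rw [u.2.2] at this
      convert this using 2
      ext x
      simp [w, T]
    have hcoef : ∀ c : T → K, (∃ i ∈ Finset.univ, c i ≠ 0) → ∃ i : T, ∑ i, c i • f i ≠ 0 ∧
        (degRevLex m).degree (∑ i, c i • f i) = (i : Fin m →₀ ℕ) := fun c hc =>
      toSyn_degree_sum_mem _ Subtype.val_injective (fun i => hF0 i) (fun i => hFle i) hc
    have hli : LinearIndependent K f := by
      rw [Fintype.linearIndependent_iff]
      intro c hc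
      by_contra! h
      obtain ⟨i, hi⟩ := h
      obtain ⟨_, h1, -⟩ := hcoef c ⟨i, Finset.mem_univ i, hi⟩
      exact h1 hc
    have hspan : Submodule.span K (Set.range f) = Submodule.span K (Set.range w) := by
      have : Module.Finite K (Submodule.span K (Set.range w)) :=
        Module.Finite.span_of_finite K (Set.finite_range w)
      refine Submodule.eq_of_le_of_finrank_le
        (Submodule.span_le.mpr (by rintro _ ⟨u, rfl⟩; exact hfw u)) ?_
      rw [finrank_span_eq_card hli]
      exact finrank_range_le_card w
    have hmem : homogeneousComponent d (distraction L h) ∈ Submodule.span K (Set.range f) := by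
      rw [hspan, homogeneousComponent_distraction hlin, distraction_eq_sum]
      refine Submodule.sum_mem _ fun u hu => Submodule.smul_mem _ _ (Submodule.subset_span ?_)
      rw [mem_support_iff, coeff_homogeneousComponent] at hu
      obtain ⟨hu1, hu2⟩ := ite_ne_right_iff.mp hu
      exact ⟨⟨u, (hE h).mp hh u (mem_support_iff.mpr hu2), hu1⟩, rfl⟩
    obtain ⟨c, hc⟩ := (Submodule.mem_span_range_iff_exists_fun K).mp hmem
    obtain ⟨i, -, hi⟩ := hcoef c (by
      by_contra! h
      rw [Finset.sum_eq_zero fun i hi => by rw [h i hi, zero_smul]] at hc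
      exact hcomp0 hc.symm)
    rw [hc, hcompl] at hi
    change monomial t₀ (1 : K) ∈ E
    rw [hi]
    exact i.2.1
  · intro f hf
    rw [f.as_sum]
    refine Ideal.sum_mem _ fun t ht => ?_
    have htE := (hE f).mp hf t ht
    rw [← mul_one (coeff t f), ← C_mul_monomial]
    refine Ideal.mul_mem_left _ _ (Ideal.subset_span ⟨F t, ⟨?_, ?_⟩, ?_⟩)
    · have hle : Submodule.span K ((fun u => distraction L (monomial u 1)) ''
          {u | monomial u (1 : K) ∈ E ∧ u.degree = t.degree}) ≤ J.restrictScalars K := by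
        refine Submodule.span_le.mpr ?_
        rintro _ ⟨u, ⟨hu, -⟩, rfl⟩
        exact (hJ _).mpr ⟨_, hu, rfl⟩
      exact hle (hFJ t htE)
    · intro h0
      exact hF0 t (by rw [h0, coeff_zero])
    · dsimp only
      rw [degree_eq_of_forall_le (hF0 t) (hFle t)]

theorem isGin_of_distraction [Infinite K] {L : Fin m → ℕ → MvPolynomial (Fin m) K}
    (hL : IsDistractionMatrix L) {E J : Ideal (MvPolynomial (Fin m) K)}
    (hE : ∀ f, f ∈ E ↔ ∀ t ∈ f.support, monomial t (1 : K) ∈ E) (hstab : IsStronglyStable E)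
    (hJ : (E.restrictScalars K).map (distraction L) = J.restrictScalars K) :
    IsGin (degRevLex m) J E := by
  obtain ⟨N, hN⟩ := hL.eventually_const
  -- Rows are constant from column `N` on, so finitely many choices of columns impose all the
  -- genericity conditions.
  refine ⟨∏ j : Fin m → Fin (N + 1), ∏ s, leadingMinor (fun i => L i (j i)) s,
    Finset.prod_ne_zero_iff.mpr fun j _ => Finset.prod_ne_zero_iff.mpr fun s _ =>
      leadingMinor_ne_zero (hL.X_mem fun i => j i) s, fun g hg => ?_⟩
  have hlin : ∀ i j, (coordChange g (L i j)).IsHomogeneous 1 := fun i j =>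
    isHomogeneous_coordChange g (hL.linear i j)
  refine initialIdeal_eq_of_leadingTerms hlin hE (fun f => ?_)
    (exists_mem_distractionSpan_leadingTerm hlin hstab fun s u => ?_)
  · rw [Ideal.mem_map_iff_of_surjective _ (coordChange_surjective g)]
    have hJ' : ∀ x, x ∈ J ↔ ∃ h ∈ E, distraction L h = x := fun x => by
      have := SetLike.ext_iff.mp hJ x
      simpa using this.symm
    constructor
    · rintro ⟨x, hx, rfl⟩
      obtain ⟨h, hh, rfl⟩ := (hJ' x).mp hx
      exact ⟨h, hh, (algHom_distraction _ L h).symm⟩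
    · rintro ⟨h, hh, rfl⟩
      exact ⟨_, (hJ' _).mpr ⟨h, hh, rfl⟩, algHom_distraction _ L h⟩
  · have hmin : ∀ i, L i (u i) = L i (min (u i) N) := fun i => by
      rcases le_total (u i) N with h | h
      · rw [min_eq_left h]
      · rw [min_eq_right h, hN i _ h]
    simp_rw [hmin]
    refine exists_sum_smul_sub_X_mem (fun r => hL.linear _ _) ?_
    rw [map_prod, Finset.prod_ne_zero_iff] at hg
    have := hg (fun i => ⟨min (u i) N, Nat.lt_succ_of_le (min_le_right _ _)⟩) (Finset.mem_univ _)
    rw [map_prod, Finset.prod_ne_zero_iff] at this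
    exact this s (Finset.mem_univ s)

end Gin

/-! ### Monomial ideals -/

section MonomialIdeal

variable {σ K : Type*} [Field K]

theorem IsMonomialIdeal.exists_eq_span {I : Ideal (MvPolynomial σ K)} (h : IsMonomialIdeal I) :
    ∃ T : Set (σ →₀ ℕ), I = Ideal.span ((fun t => monomial t (1 : K)) '' T) := by
  obtain ⟨T, hT⟩ := h
  refine ⟨T, le_antisymm (fun f hf => ?_) (Ideal.span_le.mpr fun f hf => ?_)⟩
  · have hf' : f ∈ I.restrictScalars K := hf
    rw [hT] at hf'
    have hle : Submodule.span K ((fun t => monomial t (1 : K)) '' T) ≤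
        (Ideal.span ((fun t => monomial t (1 : K)) '' T)).restrictScalars K :=
      Submodule.span_le.mpr Ideal.subset_span
    exact hle hf'
  · have : f ∈ I.restrictScalars K := hT ▸ Submodule.subset_span hf
    exact this

theorem monomial_mem_span_iff {S : Set (σ →₀ ℕ)} {t : σ →₀ ℕ} :
    monomial t (1 : K) ∈ Ideal.span ((fun s => monomial s (1 : K)) '' S) ↔ ∃ s ∈ S, s ≤ t := by
  classical
  rw [mem_ideal_span_monomial_image, support_monomial, if_neg one_ne_zero]
  simp

theorem mem_span_iff_forall_monomial_mem {S : Set (σ →₀ ℕ)} {f : MvPolynomial σ K} :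
    f ∈ Ideal.span ((fun s => monomial s (1 : K)) '' S) ↔
      ∀ t ∈ f.support, monomial t (1 : K) ∈ Ideal.span ((fun s => monomial s (1 : K)) '' S) := by
  simp_rw [monomial_mem_span_iff]
  exact mem_ideal_span_monomial_image

theorem irreducibleMonomialIdeal_eq_span (a : σ →₀ ℕ) : irreducibleMonomialIdeal K a =
    Ideal.span ((fun s => monomial s (1 : K)) ''
      ((fun i => Finsupp.single i (a i)) '' (a.support : Set σ))) := by
  rw [irreducibleMonomialIdeal, Set.image_image]
  simp_rw [X_pow_eq_monomial]

theorem monomial_mem_irreducibleMonomialIdeal_iff {a t : σ →₀ ℕ} :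
    monomial t (1 : K) ∈ irreducibleMonomialIdeal K a ↔ ∃ i, a i ≠ 0 ∧ a i ≤ t i := by
  rw [irreducibleMonomialIdeal_eq_span, monomial_mem_span_iff]
  simp

theorem mem_irreducibleMonomialIdeal_iff {a : σ →₀ ℕ} {f : MvPolynomial σ K} :
    f ∈ irreducibleMonomialIdeal K a ↔
      ∀ t ∈ f.support, monomial t (1 : K) ∈ irreducibleMonomialIdeal K a := by
  rw [irreducibleMonomialIdeal_eq_span]
  exact mem_span_iff_forall_monomial_mem

theorem exists_isIrreducibleDecomposition_subset {I : Ideal (MvPolynomial σ K)}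
    {A : Finset (σ →₀ ℕ)} (hA : A.inf (irreducibleMonomialIdeal K) = I) :
    ∃ B ⊆ A, IsIrreducibleDecomposition I B := by
  classical
  obtain ⟨B, hB, hmin⟩ := (A.powerset.filter fun B => B.inf (irreducibleMonomialIdeal K) = I)
    |>.exists_min_image Finset.card ⟨A, by simp [hA]⟩
  rw [Finset.mem_filter, Finset.mem_powerset] at hB
  refine ⟨B, hB.1, hB.2, fun C hC hCI => ?_⟩
  exact absurd (hmin C (by simp [hCI, hC.subset.trans hB.1])) (not_le.mpr (Finset.card_lt_card hC))

/-- Otherwise every generator involves another variable, and setting the other variables to zero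
maps the quotient onto `K[x]`, of dimension one. -/
theorem exists_monomial_single_mem_of_ringKrullDim_eq_zero {I : Ideal (MvPolynomial σ K)}
    (hmon : IsMonomialIdeal I) (hdim : ringKrullDim (MvPolynomial σ K ⧸ I) = 0) (i : σ) :
    ∃ k, monomial (Finsupp.single i k) (1 : K) ∈ I := by
  classical
  by_contra! hI
  let φ : MvPolynomial σ K →ₐ[K] Polynomial K := aeval fun j => if j = i then Polynomial.X else 0
  have hφ : ∀ a ∈ I, φ a = 0 := by
    obtain ⟨T, hT⟩ := hmon.exists_eq_span
    suffices h : I ≤ RingHom.ker φ from fun a ha => h ha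
    conv_lhs => rw [hT]
    refine Ideal.span_le.mpr ?_
    rintro _ ⟨t, ht, rfl⟩
    obtain ⟨j, hji, hj⟩ : ∃ j, j ≠ i ∧ t j ≠ 0 := by
      by_contra! h
      refine hI (t i) ?_
      have : Finsupp.single i (t i) = t := by
        ext j
        by_cases hj : j = i
        · subst hj; simp
        · rw [h j hj, Finsupp.single_eq_of_ne hj]
      rw [this, hT]
      exact Ideal.subset_span ⟨t, ht, rfl⟩
    rw [SetLike.mem_coe, RingHom.mem_ker]
    change aeval _ (monomial t (1 : K)) = 0
    rw [aeval_monomial, Finsupp.prod, Finset.prod_eq_zero (i := j) (by simpa using hj)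
      (by rw [if_neg hji, zero_pow hj]), mul_zero]
  have hsurj : Function.Surjective (Ideal.Quotient.lift I φ.toRingHom hφ) := fun p => by
    refine ⟨Ideal.Quotient.mk I (Polynomial.aeval (X i) p), ?_⟩
    rw [Ideal.Quotient.lift_mk]
    change φ (Polynomial.aeval (X i) p) = p
    rw [← Polynomial.aeval_algHom_apply]
    simp [φ]
  have h := ringKrullDim_le_of_surjective _ hsurj
  rw [hdim, Polynomial.ringKrullDim_of_isNoetherianRing, ringKrullDim_eq_zero_of_field,
    zero_add] at h
  exact absurd h (by decide)

end MonomialIdeal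

/-! ### Extended monomial ideals -/

section Extend

variable {n : ℕ} {K : Type*} [Field K]

/-- A strongly stable monomial ideal of `K[x_1, …, x_{n+1}]` whose generators do not involve the
last variable and which contains powers of all the other variables. -/
structure IsExtendedArtinian (E : Ideal (MvPolynomial (Fin (n + 1)) K)) : Prop where
  mem_iff : ∀ f, f ∈ E ↔ ∀ t ∈ f.support, monomial t (1 : K) ∈ E
  mono : ∀ s t : Fin (n + 1) →₀ ℕ, (∀ i, i ≠ Fin.last n → s i ≤ t i) → monomial s (1 : K) ∈ E →
    monomial t (1 : K) ∈ E
  exists_power : ∀ i, i ≠ Fin.last n → ∃ k, monomial (Finsupp.single i k) (1 : K) ∈ E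

theorem extendIdeal_span (T : Set (Fin n →₀ ℕ)) :
    extendIdeal (Ideal.span ((fun t => monomial t (1 : K)) '' T)) =
      Ideal.span ((fun t => monomial t (1 : K)) '' (Finsupp.mapDomain Fin.castSucc '' T)) := by
  rw [extendIdeal, Ideal.map_span, Set.image_image, Set.image_image]
  simp_rw [rename_monomial]

theorem mapDomain_castSucc_last (t : Fin n →₀ ℕ) :
    Finsupp.mapDomain Fin.castSucc t (Fin.last n) = 0 :=
  Finsupp.mapDomain_of_notMem_range _ _ (by rintro ⟨i, hi⟩; exact (Fin.castSucc_lt_last i).ne hi)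

theorem mapDomain_castSucc_castSucc (t : Fin n →₀ ℕ) (i : Fin n) :
    Finsupp.mapDomain Fin.castSucc t i.castSucc = t i :=
  Finsupp.mapDomain_apply (Fin.castSucc_injective n) _ _

theorem isExtendedArtinian_extendIdeal {I : Ideal (MvPolynomial (Fin n) K)}
    (hmon : IsMonomialIdeal I) (hdim : ringKrullDim (MvPolynomial (Fin n) K ⧸ I) = 0) :
    IsExtendedArtinian (extendIdeal I) := by
  have hpow := exists_monomial_single_mem_of_ringKrullDim_eq_zero hmon hdim
  obtain ⟨T, rfl⟩ := hmon.exists_eq_span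
  rw [extendIdeal_span]
  refine ⟨fun f => mem_span_iff_forall_monomial_mem, fun s t hst => ?_, fun i hi => ?_⟩
  · simp_rw [monomial_mem_span_iff]
    rintro ⟨_, ⟨u, hu, rfl⟩, hus⟩
    refine ⟨_, ⟨u, hu, rfl⟩, fun i => ?_⟩
    by_cases hi : i = Fin.last n
    · rw [hi, mapDomain_castSucc_last]
      exact Nat.zero_le _
    · exact (hus i).trans (hst i hi)
  · obtain ⟨i, rfl⟩ := Fin.exists_castSucc_eq.mpr hi
    obtain ⟨k, hk⟩ := hpow i
    refine ⟨k, ?_⟩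
    rw [monomial_mem_span_iff] at hk ⊢
    obtain ⟨s, hs, hsk⟩ := hk
    refine ⟨_, ⟨s, hs, rfl⟩, ?_⟩
    rw [← Finsupp.mapDomain_single]
    exact Finsupp.mapDomain_mono hsk

theorem isStronglyStable_extendIdeal {I : Ideal (MvPolynomial (Fin n) K)}
    (hmon : IsMonomialIdeal I) (hstab : IsStronglyStable I) :
    IsStronglyStable (extendIdeal I) := by
  obtain ⟨T, rfl⟩ := hmon.exists_eq_span
  rw [extendIdeal_span]
  intro t ht i j hij htj
  rw [monomial_mem_span_iff] at ht ⊢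
  obtain ⟨_, ⟨s, hs, rfl⟩, hst⟩ := ht
  by_cases hsj : Finsupp.mapDomain Fin.castSucc s j = 0
  · refine ⟨_, ⟨s, hs, rfl⟩, fun k => ?_⟩
    have hk := hst k
    simp only [Finsupp.add_apply, Finsupp.tsub_apply]
    by_cases hkj : k = j
    · rw [hkj, hsj]; exact Nat.zero_le _
    · rw [Finsupp.single_eq_of_ne hkj]
      omega
  · obtain ⟨j, rfl⟩ := Fin.exists_castSucc_eq.mpr fun h : j = Fin.last n =>
      hsj (h ▸ mapDomain_castSucc_last s)
    obtain ⟨i, rfl⟩ := Fin.exists_castSucc_eq.mpr (hij.trans_lt (Fin.castSucc_lt_last j)).ne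
    rw [mapDomain_castSucc_castSucc] at hsj
    have h := hstab s (Ideal.subset_span ⟨s, hs, rfl⟩) i j (by simpa using hij) hsj
    obtain ⟨u, hu, hus⟩ := monomial_mem_span_iff.mp h
    refine ⟨_, ⟨u, hu, rfl⟩, (Finsupp.mapDomain_mono hus).trans fun k => ?_⟩
    rcases Fin.eq_castSucc_or_eq_last k with ⟨k, rfl⟩ | rfl
    · have hk := hst k.castSucc
      rw [mapDomain_castSucc_castSucc] at hk ⊢
      simp only [Finsupp.add_apply, Finsupp.tsub_apply, Finsupp.single_apply,
        Fin.castSucc_inj]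
      omega
    · rw [mapDomain_castSucc_last]
      exact Nat.zero_le _

theorem IsExtendedArtinian.finite_standard {E : Ideal (MvPolynomial (Fin (n + 1)) K)}
    (hE : IsExtendedArtinian E) :
    {t : Fin (n + 1) →₀ ℕ | t (Fin.last n) = 0 ∧ monomial t (1 : K) ∉ E}.Finite := by
  have : ∀ i, ∃ k, ∀ t : Fin (n + 1) →₀ ℕ, t (Fin.last n) = 0 ∧ monomial t (1 : K) ∉ E →
      t i ≤ k := fun i => by
    by_cases hi : i = Fin.last n
    · exact ⟨0, fun t ht => by rw [hi, ht.1]⟩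
    · obtain ⟨k, hk⟩ := hE.exists_power i hi
      refine ⟨k, fun t ht => ?_⟩
      by_contra h
      refine ht.2 (hE.mono _ t (fun l _ => ?_) hk)
      by_cases hl : l = i
      · rw [hl, Finsupp.single_eq_same]
        exact (not_le.mp h).le
      · rw [Finsupp.single_eq_of_ne hl]
        exact Nat.zero_le _
  choose b hb using this
  exact (Set.finite_Iic (Finsupp.equivFunOnFinite.symm b)).subset fun t ht i => hb i t ht

end Extend

/-! ### Irreducible components of extended ideals -/

section Component

variable {n : ℕ} {K : Type*} [Field K]

/-- `E` is the intersection of the ideals `(x_i ^ (o i + 1) : i ≠ last)` over standard `o`. In an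
irredundant subfamily some member still excludes `s`. -/
theorem IsExtendedArtinian.exists_isIrreducibleComponent
    {E : Ideal (MvPolynomial (Fin (n + 1)) K)} (hE : IsExtendedArtinian E)
    {s : Fin (n + 1) →₀ ℕ} (hs : monomial s (1 : K) ∉ E) :
    ∃ a, IsIrreducibleComponent E a ∧ (a.support : Set (Fin (n + 1))) = {i | i ≠ Fin.last n} ∧
      ∀ i, i ≠ Fin.last n → s i < a i := by
  classical
  let one : Fin (n + 1) →₀ ℕ :=
    Finsupp.equivFunOnFinite.symm fun i => if i = Fin.last n then 0 else 1
  have hone : ∀ i, i ≠ Fin.last n → one i = 1 := fun i hi => if_neg hi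
  have hone' : one (Fin.last n) = 0 := if_pos rfl
  have hirr : ∀ o t : Fin (n + 1) →₀ ℕ, o (Fin.last n) = 0 →
      (monomial t (1 : K) ∈ irreducibleMonomialIdeal K (o + one) ↔
        ∃ i, i ≠ Fin.last n ∧ o i < t i) := fun o t ho => by
    rw [monomial_mem_irreducibleMonomialIdeal_iff]
    refine exists_congr fun i => ?_
    by_cases hi : i = Fin.last n
    · simp [hi, ho, hone']
    · simp [hi, hone i hi]
  let A := hE.finite_standard.toFinset.image fun o => o + one
  have hA : A.inf (irreducibleMonomialIdeal K) = E := by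
    ext f
    rw [Submodule.mem_finsetInf, hE.mem_iff]
    have hmem : ∀ t, monomial t (1 : K) ∈ E ↔
        ∀ a ∈ A, monomial t (1 : K) ∈ irreducibleMonomialIdeal K a := fun t => by
      simp only [A, Finset.forall_mem_image, Set.Finite.mem_toFinset, Set.mem_ofPred_eq]
      constructor
      · intro ht o ho
        rw [hirr o t ho.1]
        by_contra! h
        exact ho.2 (hE.mono t o h ht)
      · intro h
        by_contra ht
        -- The standard `o` whose ideal excludes `t` is `t` without its last variable.
        have ho := h (x := t.erase (Fin.last n)) ⟨Finsupp.erase_same, fun h' =>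
          ht (hE.mono _ _ (fun i hi => (Finsupp.erase_ne hi).le) h')⟩
        rw [hirr _ t Finsupp.erase_same] at ho
        obtain ⟨i, hi, hlt⟩ := ho
        rw [Finsupp.erase_ne hi] at hlt
        exact hlt.false
    constructor
    · intro h t ht
      exact (hmem t).mpr fun a ha => mem_irreducibleMonomialIdeal_iff.mp (h a ha) t ht
    · intro h a ha
      exact mem_irreducibleMonomialIdeal_iff.mpr fun t ht => (hmem t).mp (h t ht) a ha
  obtain ⟨B, hBA, hB⟩ := exists_isIrreducibleDecomposition_subset hA
  rw [← hB.1, Submodule.mem_finsetInf] at hs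
  push Not at hs
  obtain ⟨a, ha, has⟩ := hs
  have haA := hBA ha
  simp only [A, Finset.mem_image, Set.Finite.mem_toFinset, Set.mem_ofPred_eq] at haA
  obtain ⟨o, ⟨ho, -⟩, rfl⟩ := haA
  refine ⟨_, ⟨B, hB, ha⟩, ?_, fun i hi => ?_⟩
  · ext i
    by_cases hi : i = Fin.last n
    · simp [hi, ho, hone']
    · simp [hi, hone i hi]
  · rw [hirr o s ho] at has
    push Not at has
    have := has i hi
    rw [Finsupp.add_apply, hone i hi]
    omega

end Component

/-! ### Points -/

section Points

variable {n : ℕ} {K : Type*} [Field K]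

theorem IsHomogeneous.eval_smul_eq {σ : Type*} [Fintype σ] {f : MvPolynomial σ K} {d : ℕ}
    (hf : f.IsHomogeneous d) (c : K) (v : σ → K) : eval (c • v) f = c ^ d * eval v f := by
  rw [eval_eq', eval_eq', Finset.mul_sum]
  refine Finset.sum_congr rfl fun t ht => ?_
  have : t.degree = d := by
    by_contra h
    exact mem_support_iff.mp ht (hf.coeff_eq_zero h)
  simp only [Pi.smul_apply, smul_eq_mul, mul_pow, Finset.prod_mul_distrib]
  rw [Finset.prod_pow_eq_pow_sum, ← Finsupp.degree_eq_sum, this]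
  ring

theorem exists_ne_zero_eval_eq_zero {L : Fin (n + 1) → ℕ → MvPolynomial (Fin (n + 1)) K}
    (hL : ∀ i j, (L i j).IsHomogeneous 1) (s : Fin (n + 1) → ℕ) :
    ∃ v : Fin (n + 1) → K, v ≠ 0 ∧ ∀ i, i ≠ Fin.last n → eval v (L i (s i)) = 0 := by
  let A : Matrix (Fin n) (Fin (n + 1)) K :=
    Matrix.of fun i k => coeff (Finsupp.single k 1) (L i.castSucc (s i.castSucc))
  have hker : LinearMap.ker A.mulVecLin ≠ ⊥ := LinearMap.ker_ne_bot_of_finrank_lt (by simp)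
  obtain ⟨v, hv, hv0⟩ := (Submodule.ne_bot_iff _).mp hker
  refine ⟨v, hv0, fun i hi => ?_⟩
  obtain ⟨i, rfl⟩ := Fin.exists_castSucc_eq.mpr hi
  have := congrFun (LinearMap.mem_ker.mp hv) i
  rw [IsHomogeneous.eq_sum_coeff_smul_X (hL _ _), map_sum]
  simpa [A, Matrix.mulVec, dotProduct, smul_eval] using this

variable {L : Fin (n + 1) → ℕ → MvPolynomial (Fin (n + 1)) K}

theorem IsDistractionMatrix.eval_last_ne_zero (hL : IsDistractionMatrix L) {s : Fin (n + 1) → ℕ}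
    {v : Fin (n + 1) → K} (hv : v ≠ 0) (hvs : ∀ i, i ≠ Fin.last n → eval v (L i (s i)) = 0)
    (j : ℕ) : eval v (L (Fin.last n) j) ≠ 0 := by
  intro h
  apply hv
  ext k
  obtain ⟨c, hc⟩ := (Submodule.mem_span_range_iff_exists_fun K).mp
    (hL.X_mem (Function.update s (Fin.last n) j) k)
  have hk := congrArg (eval v) hc
  rw [eval_X, map_sum, Finset.sum_eq_zero] at hk
  · exact hk.symm
  · intro i _
    rw [smul_eval]
    by_cases hi : i = Fin.last n
    · rw [hi, Function.update_self, h, mul_zero]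
    · rw [Function.update_of_ne hi, hvs i hi, mul_zero]

/-- Expand a linear form in the `L i (s i)`; evaluation at `v` sees only the coefficient of the last
one. The span is thus determined by `v` alone. -/
theorem IsDistractionMatrix.mem_span_image_iff (hL : IsDistractionMatrix L)
    {s : Fin (n + 1) → ℕ} {v : Fin (n + 1) → K} (hv : v ≠ 0)
    (hvs : ∀ i, i ≠ Fin.last n → eval v (L i (s i)) = 0) (f : MvPolynomial (Fin (n + 1)) K) :
    f ∈ Submodule.span K ((fun i => L i (s i)) '' {i | i ≠ Fin.last n}) ↔
      f.IsHomogeneous 1 ∧ eval v f = 0 := by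
  constructor
  · intro hf
    induction hf using Submodule.span_induction with
    | mem x hx =>
      obtain ⟨i, hi, rfl⟩ := hx
      exact ⟨hL.linear _ _, hvs i hi⟩
    | zero => exact ⟨isHomogeneous_zero _ _ _, map_zero _⟩
    | add x y _ _ hx hy => exact ⟨hx.1.add hy.1, by rw [map_add, hx.2, hy.2, add_zero]⟩
    | smul a x _ hx =>
      exact ⟨(homogeneousSubmodule _ K 1).smul_mem a hx.1, by rw [smul_eval, hx.2, mul_zero]⟩
  · rintro ⟨hf, hf0⟩
    have hf' : f ∈ homogeneousSubmodule (Fin (n + 1)) K 1 := hf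
    rw [← hL.span_eq s] at hf'
    obtain ⟨c, rfl⟩ := (Submodule.mem_span_range_iff_exists_fun K).mp hf'
    rw [map_sum, Finset.sum_eq_single (Fin.last n), smul_eval] at hf0
    · have hc := (mul_eq_zero.mp hf0).resolve_right (hL.eval_last_ne_zero hv hvs _)
      refine Submodule.sum_mem _ fun i _ => ?_
      by_cases hi : i = Fin.last n
      · rw [hi, hc, zero_smul]
        exact Submodule.zero_mem _
      · exact Submodule.smul_mem _ _ (Submodule.subset_span ⟨i, hi, rfl⟩)
    · intro i _ hi
      rw [smul_eval, hvs i hi, mul_zero]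
    · simp

/-- If `L i j` vanished at `v`, replacing `s i` by `j` would give a second choice spanning the same
space, that of all linear forms vanishing at `v`, against radicality. -/
theorem IsDistractionMatrix.eval_ne_zero_of_isRadicalForIrreducible (hL : IsDistractionMatrix L)
    {a : Fin (n + 1) →₀ ℕ} (ha : (a.support : Set (Fin (n + 1))) = {i | i ≠ Fin.last n})
    (hrad : IsRadicalForIrreducible L a) {s : Fin (n + 1) → ℕ}
    (hs : ∀ i, i ≠ Fin.last n → s i < a i) {v : Fin (n + 1) → K} (hv : v ≠ 0)
    (hvs : ∀ i, i ≠ Fin.last n → eval v (L i (s i)) = 0) {i : Fin (n + 1)}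
    (hi : i ≠ Fin.last n) {j : ℕ} (hj : j < s i) : eval v (L i j) ≠ 0 := by
  intro h
  have hmem : ∀ k : a.support, (k : Fin (n + 1)) ≠ Fin.last n := fun k => by
    have : (k : Fin (n + 1)) ∈ (a.support : Set (Fin (n + 1))) := k.2
    rwa [ha] at this
  have hspan : ∀ s' : Fin (n + 1) → ℕ, (∀ i, i ≠ Fin.last n → eval v (L i (s' i)) = 0) →
      ∀ f, f ∈ Submodule.span K (Set.range fun i : a.support => L i (s' i)) ↔
        f.IsHomogeneous 1 ∧ eval v f = 0 := fun s' hs' f => by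
    rw [← hL.mem_span_image_iff hv hs', ← ha, Set.image_eq_range]
    rfl
  have hupd : ∀ k, k ≠ Fin.last n → eval v (L k (Function.update s i j k)) = 0 := fun k hk => by
    by_cases hki : k = i
    · rw [hki, Function.update_self, h]
    · rw [Function.update_of_ne hki, hvs k hk]
  have heq := hrad (x₁ := fun k : a.support => s k)
    (x₂ := fun k : a.support => Function.update s i j k) (fun k => hs k (hmem k))
    (fun k => by
      dsimp only
      by_cases hki : (k : Fin (n + 1)) = i
      · rw [hki, Function.update_self]
        exact hj.trans (hs i hi)
      · rw [Function.update_of_ne hki]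
        exact hs k (hmem k))
    (Submodule.ext fun f => (hspan s hvs f).trans (hspan _ hupd f).symm)
  have hia : i ∈ a.support := by
    have : i ∈ (a.support : Set (Fin (n + 1))) := by rw [ha]; exact hi
    exact this
  have := congrFun heq ⟨i, hia⟩
  simp only [Function.update_self] at this
  omega

theorem eval_distraction_monomial_eq_zero {σ : Type*} [Fintype σ] {L : σ → ℕ → MvPolynomial σ K}
    {v : σ → K} {s t : σ →₀ ℕ} {i : σ} (hi : eval v (L i (s i)) = 0) (hst : s i < t i) :
    eval v (distraction L (monomial t 1)) = 0 := by
  rw [distraction_monomial, map_prod]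
  refine Finset.prod_eq_zero (Finset.mem_univ i) ?_
  rw [map_prod]
  exact Finset.prod_eq_zero (Finset.mem_range.mpr hst) hi

/-- Vanishing is independent of the representative only for homogeneous polynomials, so the test is
made on components; it suffices because the ideal is homogeneous. -/
theorem mem_idealOfPoints_image_mk {ι : Type*} {v : ι → Fin (n + 1) → K} (hv : ∀ o, v o ≠ 0)
    (O : Set ι) {f : MvPolynomial (Fin (n + 1)) K} :
    f ∈ idealOfPoints ((fun o => Projectivization.mk K (v o) (hv o)) '' O) ↔
      ∀ o ∈ O, ∀ d, eval (v o) (homogeneousComponent d f) = 0 := by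
  have hrep : ∀ (o : ι) (d : ℕ) (f : MvPolynomial (Fin (n + 1)) K), f.IsHomogeneous d →
      (eval (Projectivization.mk K (v o) (hv o)).rep f = 0 ↔ eval (v o) f = 0) :=
    fun o d f hf => by
      obtain ⟨c, hc⟩ := Projectivization.exists_smul_eq_mk_rep K (v o) (hv o)
      rw [← hc, Units.smul_def, IsHomogeneous.eval_smul_eq hf]
      simp
  constructor
  · intro hf o ho d
    let _ := gradedAlgebra (σ := Fin (n + 1)) (R := K)
    have hhom : (idealOfPoints ((fun o => Projectivization.mk K (v o) (hv o)) '' O)).IsHomogeneous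
        (homogeneousSubmodule (Fin (n + 1)) K) :=
      Ideal.homogeneous_span _ _ fun x hx => hx.1
    have hfd : homogeneousComponent d f ∈
        idealOfPoints ((fun o => Projectivization.mk K (v o) (hv o)) '' O) := by
      rw [← decomposition.decompose'_apply]
      exact hhom d hf
    have hle : idealOfPoints ((fun o => Projectivization.mk K (v o) (hv o)) '' O) ≤
        RingHom.ker (eval (v o)) := by
      refine Ideal.span_le.mpr ?_
      rintro x ⟨⟨e, hx⟩, hx0⟩
      exact (hrep o e x hx).mp (hx0 _ ⟨o, ho, rfl⟩)
    exact hle hfd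
  · intro h
    rw [← sum_homogeneousComponent f]
    refine Ideal.sum_mem _ fun d _ => Ideal.subset_span
      ⟨⟨d, homogeneousComponent_isHomogeneous d f⟩, ?_⟩
    rintro _ ⟨o, ho, rfl⟩
    exact (hrep o d _ (homogeneousComponent_isHomogeneous d f)).mpr (h o ho d)

theorem map_distraction_eq_idealOfPoints {E : Ideal (MvPolynomial (Fin (n + 1)) K)}
    (hE : IsExtendedArtinian E) (hL : IsDistractionMatrix L) (hrad : IsRadicalFor L E)
    {v : (Fin (n + 1) →₀ ℕ) → Fin (n + 1) → K} (hv : ∀ o, v o ≠ 0)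
    (hvo : ∀ o i, i ≠ Fin.last n → eval (v o) (L i (o i)) = 0) :
    (E.restrictScalars K).map (distraction L) =
      (idealOfPoints ((fun o => Projectivization.mk K (v o) (hv o)) ''
        {t | t (Fin.last n) = 0 ∧ monomial t (1 : K) ∉ E})).restrictScalars K := by
  have hvanish : ∀ o t, monomial o (1 : K) ∉ E → monomial t (1 : K) ∈ E →
      eval (v o) (distraction L (monomial t 1)) = 0 := fun o t ho ht => by
    obtain ⟨i, hi, hlt⟩ : ∃ i, i ≠ Fin.last n ∧ o i < t i := by
      by_contra! h
      exact ho (hE.mono t o h ht)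
    exact eval_distraction_monomial_eq_zero (hvo o i hi) hlt
  ext f
  rw [Submodule.mem_map, Submodule.restrictScalars_mem, mem_idealOfPoints_image_mk hv]
  constructor
  · rintro ⟨h, hh, rfl⟩ o ho d
    rw [homogeneousComponent_distraction hL.linear, distraction_eq_sum, map_sum]
    refine Finset.sum_eq_zero fun t ht => ?_
    rw [mem_support_iff, coeff_homogeneousComponent] at ht
    rw [smul_eval, hvanish o t ho.2 ((hE.mem_iff h).mp hh t
      (mem_support_iff.mpr (ite_ne_right_iff.mp ht).2)), mul_zero]
  · intro hf
    obtain ⟨h, rfl⟩ := distraction_surjective hL.X_mem f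
    refine ⟨h, ?_, rfl⟩
    rw [Submodule.restrictScalars_mem, hE.mem_iff]
    by_contra! hex
    classical
    -- Maximality of the last exponent isolates `t` at the point of `o`: a nonstandard-free
    -- competitor `t'` of the same degree, bounded by `o` off the last variable, would divide `t`
    -- and hence equal it.
    obtain ⟨t, ht, hmax⟩ := (h.support.filter fun t => monomial t (1 : K) ∉ E).exists_max_image
      (fun t => t (Fin.last n)) (by
        obtain ⟨t, ht⟩ := hex
        exact ⟨t, Finset.mem_filter.mpr ht⟩)
    rw [Finset.mem_filter] at ht
    set o := t.erase (Fin.last n) with ho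
    have hoi : ∀ i, i ≠ Fin.last n → o i = t i := fun i hi => Finsupp.erase_ne hi
    have hoE : monomial o (1 : K) ∉ E := fun h' =>
      ht.2 (hE.mono _ _ (fun i hi => (hoi i hi).le) h')
    have h0 := hf o ⟨Finsupp.erase_same, hoE⟩ t.degree
    rw [homogeneousComponent_distraction hL.linear, distraction_eq_sum, map_sum,
      Finset.sum_eq_single t, smul_eval, coeff_homogeneousComponent, if_pos rfl] at h0
    · have h1 := (mul_eq_zero.mp h0).resolve_left (mem_support_iff.mp ht.1)
      rw [distraction_monomial, map_prod] at h1
      obtain ⟨i, -, hi⟩ := Finset.prod_eq_zero_iff.mp h1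
      rw [map_prod] at hi
      obtain ⟨j, hj, hij⟩ := Finset.prod_eq_zero_iff.mp hi
      by_cases hil : i = Fin.last n
      · rw [hil] at hij
        exact hL.eval_last_ne_zero (hv o) (hvo o) j hij
      · obtain ⟨a, ha, hasupp, hao⟩ := hE.exists_isIrreducibleComponent hoE
        rw [Finset.mem_range, ← hoi i hil] at hj
        exact hL.eval_ne_zero_of_isRadicalForIrreducible hasupp (hrad a ha) hao (hv o) (hvo o)
          hil hj hij
    · intro t' ht' hne
      rw [mem_support_iff, coeff_homogeneousComponent] at ht'
      obtain ⟨hdeg, hco⟩ := ite_ne_right_iff.mp ht'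
      rw [smul_eval]
      by_cases htE : monomial t' (1 : K) ∈ E
      · rw [hvanish o t' hoE htE, mul_zero]
      obtain ⟨i, hi, hlt⟩ : ∃ i, i ≠ Fin.last n ∧ o i < t' i := by
        by_contra! hle
        have hlast := hmax t' (Finset.mem_filter.mpr ⟨mem_support_iff.mpr hco, htE⟩)
        have hle' : t' ≤ t := fun i => by
          by_cases hi : i = Fin.last n
          · rw [hi]; exact hlast
          · rw [← hoi i hi]; exact hle i hi
        have hadd := tsub_add_cancel_of_le hle'
        have hd := congrArg Finsupp.degree hadd
        rw [map_add, hdeg, add_eq_right, Finsupp.degree_eq_zero_iff] at hd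
        rw [hd, zero_add] at hadd
        exact hne hadd
      rw [eval_distraction_monomial_eq_zero (hvo o i hi) hlt, mul_zero]
    · intro ht'
      rw [notMem_support_iff] at ht'
      rw [ht', zero_smul, map_zero]

end Points

end GinPoints

theorem mainTheorem4 {K : Type*} [Field K] [Infinite K] {n : ℕ}
    (I : Ideal (MvPolynomial (Fin n) K)) (hmon : IsMonomialIdeal I) (hstab : IsStronglyStable I)
    (hdim : ringKrullDim (MvPolynomial (Fin n) K ⧸ I) = 0)
    (L : Fin (n + 1) → ℕ → MvPolynomial (Fin (n + 1)) K) (hL : IsDistractionMatrix L)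
    (hrad : IsRadicalFor L (extendIdeal I)) :
    ∃ Z : Finset (Projectivization K (Fin (n + 1) → K)),
      ((extendIdeal I).restrictScalars K).map (distraction L) =
        (idealOfPoints (Z : Set (Projectivization K (Fin (n + 1) → K)))).restrictScalars K ∧
      IsGin (degRevLex (n + 1))
        (idealOfPoints (Z : Set (Projectivization K (Fin (n + 1) → K)))) (extendIdeal I) := by
  have hE := isExtendedArtinian_extendIdeal hmon hdim
  choose v hv hvo using fun o : Fin (n + 1) →₀ ℕ => exists_ne_zero_eval_eq_zero hL.linear o
  have hZ := map_distraction_eq_idealOfPoints hE hL hrad hv hvo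
  refine ⟨(hE.finite_standard.image fun o => Projectivization.mk K (v o) (hv o)).toFinset, ?_⟩
  rw [Set.Finite.coe_toFinset]
  exact ⟨hZ, isGin_of_distraction hL hE.mem_iff (isStronglyStable_extendIdeal hmon hstab) hZ⟩
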